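/- Let $z_1,z_2,\ldots$ be i.i.d. Bernoulli random variables with unknown mean $\mu_z\in[0,1]$. A sequential algorithm $\mathcal A$ (possibly using internal randomness independent of the $z_i$) inspects $z_1,z_2,\ldots$ in ascending order, decides after each inspected value, on the basis of the values seen so far and its internal randomness, whether to stop, and when it stops returns a real number $\tilde\mu_z$. Its running time counts one unit for each inspected value plus an arbitrary number of steps of internal computation. Say that $\mathcal A$ is $(\varepsilon,\delta)$-accurate if, for every value $\mu_z\in[0,1]$ of the mean, with probability at least $1-\delta$ it stops and returns $\tilde\mu_z$ with $|\tilde\mu_z-\mu_z|\le\varepsilon$. Then every $(\varepsilon,\delta)$-accurate algorithm uses $$\Omega\!\left(\frac{\max\{\mu_z,\varepsilon\}}{\varepsilon^2}\log\frac1\delta\right)$$ samples in expectation when $\mu_z<0.5$, and therefore also has at least this expected running time. Precisely: for all real $\varepsilon_0,\delta_0$ with $2\varepsilon_0+\delta_0<1$ there is a constant $c>0$, depending only on $\varepsilon_0$ and $\delta_0$, such that for all $0<\varepsilon\le\varepsilon_0$ and $0<\delta\le\delta_0$, every $(\varepsilon,\delta)$-accurate sequential algorithm, and every mean $\mu_z\in[0,0.5)$,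 both the expected number of inspected values and the expected running time under $\mu_z$ are at least $$c\cdot\frac{\max\{\mu_z,\varepsilon\}}{\varepsilon^2}\log\frac1\delta .$$ (These expectations take values in $[0,\infty]$; in particular the bound covers all algorithms with finite expected running time.) -/

import Mathlib

open MeasureTheory ProbabilityTheory
open scoped ENNReal unitInterval

noncomputable section

/-- A (possibly randomized) sequential algorithm that inspects a sequence `z 0, z 1, z 2, …` of
bits in ascending order. All its internal random choices are encoded in a seed, drawn from
`seedLaw` independently of the bits. After having inspected exactly the `n` bits
`w : Fin n → Bool`, the algorithm with seed `r` performs `work n r w` elementary steps of internal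
computation, and then either halts (`halts n r w = true`) and returns the number `output n r w`,
or inspects the next bit. -/
structure SequentialAlgorithm (Seed : Type*) [MeasurableSpace Seed] where
  seedLaw : Measure Seed
  isProbabilityMeasure_seedLaw : IsProbabilityMeasure seedLaw
  halts : (n : ℕ) → Seed → (Fin n → Bool) → Bool
  output : (n : ℕ) → Seed → (Fin n → Bool) → ℝ
  work : (n : ℕ) → Seed → (Fin n → Bool) → ℕ
  measurable_halts : ∀ (n : ℕ) (w : Fin n → Bool), Measurable fun r => halts n r w
  measurable_output : ∀ (n : ℕ) (w : Fin n → Bool), Measurable fun r => output n r w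
  measurable_work : ∀ (n : ℕ) (w : Fin n → Bool), Measurable fun r => work n r w

/-- The first `n` bits of an infinite sequence. -/
def initialBits (n : ℕ) (z : ℕ → Bool) : Fin n → Bool := fun i => z i

/-- The law of an infinite sequence of i.i.d. Bernoulli bits with mean `μ`
(`true` stands for `1` and `false` for `0`). -/
def bernoulliSequence (μ : I) : Measure (ℕ → Bool) :=
  Measure.infinitePi fun _ : ℕ => bernoulliMeasure true false μ

namespace SequentialAlgorithm

variable {Seed : Type*} [MeasurableSpace Seed]

/-- The number of bits inspected by the algorithm on seed `p.1` and bit sequence `p.2`: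
the first `n` at which it halts, and `⊤` if it never halts. -/
def samples (A : SequentialAlgorithm Seed) (p : Seed × (ℕ → Bool)) : ℕ∞ :=
  ⨅ (n : ℕ) (_ : A.halts n p.1 (initialBits n p.2) = true), (n : ℕ∞)

/-- The running time: one unit for each inspected bit, plus all the internal computation
performed until the algorithm halts. -/
def runningTime (A : SequentialAlgorithm Seed) (p : Seed × (ℕ → Bool)) : ℝ≥0∞ :=
  (A.samples p : ℝ≥0∞) +
    ∑' n : ℕ, if (n : ℕ∞) ≤ A.samples p then (A.work n p.1 (initialBits n p.2) : ℝ≥0∞) else 0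

/-- The joint law of the seed and of the i.i.d. Bernoulli bits with mean `μ`. -/
def runLaw (A : SequentialAlgorithm Seed) (μ : I) : Measure (Seed × (ℕ → Bool)) :=
  A.seedLaw.prod (bernoulliSequence μ)

/-- The runs on which the algorithm halts and returns an estimate of `μ` with error at most `ε`. -/
def successEvent (A : SequentialAlgorithm Seed) (ε : ℝ) (μ : I) : Set (Seed × (ℕ → Bool)) :=
  {p | ∃ n : ℕ, A.samples p = n ∧ |A.output n p.1 (initialBits n p.2) - (μ : ℝ)| ≤ ε}

/-- Whatever the mean of the bits, the algorithm estimates it within additive error `ε`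
with probability at least `1 - δ`. -/
def EstimatesMean (A : SequentialAlgorithm Seed) (ε δ : ℝ) : Prop :=
  ∀ μ : I, 1 - δ ≤ (A.runLaw μ).real (A.successEvent ε μ)

/-- The expected number of inspected bits when their mean is `μ`. -/
def expectedSamples (A : SequentialAlgorithm Seed) (μ : I) : ℝ≥0∞ :=
  ∫⁻ p, (A.samples p : ℝ≥0∞) ∂(A.runLaw μ)

/-- The expected running time when the mean of the bits is `μ`. -/
def expectedTime (A : SequentialAlgorithm Seed) (μ : I) : ℝ≥0∞ :=
  ∫⁻ p, A.runningTime p ∂(A.runLaw μ)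

end SequentialAlgorithm

end

/-! Change of measure against several alternatives. Take `K` means pairwise more than `2 * ε` apart.
Their success events are disjoint, so under `μ` some `ν` among them is hit with probability at most
`ρ = 1 / K` (`exists_successEvent_le`), while under `ν` accuracy forces probability at least `1 -
δ`. A single alternative would only handle `δ` below `1 / 2`; the hypothesis `2 * ε₀ + δ₀ < 1` is
what lets `K` means fit in the unit interval with `1 / K + δ₀ < 1`.

Wald's identity and data processing then bound the divergence of the bits `ρ` and `1 - δ` by the
expected sample size under `μ` times the divergence of one bit of mean `μ` from one of mean `ν`
(`score_le`, `divergence_le_mul_expectedSamples`). The former is at least a constant times `log (1 /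
δ)` (`exists_mul_log_le_divergence`); the latter is at most `χ²`, of order `ε ^ 2 / max μ ε` for
well-chosen means (`exists_separated_means`). -/

/-! ### Expectations over finite words -/

/-- The probability of the word `w` when its letters are independent with law `p`. -/
noncomputable def wordWeight (p : Bool → ℝ) {n : ℕ} (w : Fin n → Bool) : ℝ := ∏ i, p (w i)

/-- The expectation of `g` over words of length `n` with independent letters of law `p`. -/
noncomputable def wordMean (p : Bool → ℝ) {n : ℕ} (g : (Fin n → Bool) → ℝ) : ℝ :=
  ∑ w, wordWeight p w * g w

/-- The sum of the scores of the letters of `w`. -/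
noncomputable def wordScore (s : Bool → ℝ) {n : ℕ} (w : Fin n → Bool) : ℝ := ∑ i, s (w i)

lemma wordWeight_snoc (p : Bool → ℝ) {n : ℕ} (v : Fin n → Bool) (b : Bool) :
    wordWeight p (Fin.snoc v b : Fin (n + 1) → Bool) = wordWeight p v * p b := by
  simp [wordWeight, Fin.prod_univ_castSucc]

lemma wordScore_snoc (s : Bool → ℝ) {n : ℕ} (v : Fin n → Bool) (b : Bool) :
    wordScore s (Fin.snoc v b : Fin (n + 1) → Bool) = wordScore s v + s b := by
  simp [wordScore, Fin.sum_univ_castSucc]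

lemma sum_words_succ {n : ℕ} (F : (Fin (n + 1) → Bool) → ℝ) :
    ∑ w, F w = ∑ v : Fin n → Bool, (F (Fin.snoc v true) + F (Fin.snoc v false)) := by
  rw [← (Fin.snocEquiv fun _ => Bool).sum_comp, Fintype.sum_prod_type_right]
  simp [Fin.snocEquiv]

lemma wordWeight_nonneg {p : Bool → ℝ} (hp : ∀ b, 0 ≤ p b) {n : ℕ} (w : Fin n → Bool) :
    0 ≤ wordWeight p w := Finset.prod_nonneg fun _ _ => hp _

lemma wordMean_add (p : Bool → ℝ) {n : ℕ} (f g : (Fin n → Bool) → ℝ) :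
    wordMean p (fun w => f w + g w) = wordMean p f + wordMean p g := by
  simp [wordMean, mul_add, Finset.sum_add_distrib]

lemma wordMean_nonneg {p : Bool → ℝ} (hp : ∀ b, 0 ≤ p b) {n : ℕ} {g : (Fin n → Bool) → ℝ}
    (h : ∀ w, 0 ≤ g w) : 0 ≤ wordMean p g :=
  Finset.sum_nonneg fun w _ => mul_nonneg (wordWeight_nonneg hp w) (h w)

lemma wordMean_init {p : Bool → ℝ} (hp : p true + p false = 1) {n : ℕ}
    (g : (Fin n → Bool) → ℝ) :
    wordMean p (fun w : Fin (n + 1) → Bool => g (Fin.init w)) = wordMean p g := by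
  rw [wordMean, sum_words_succ, wordMean]
  refine Finset.sum_congr rfl fun v _ => ?_
  simp only [wordWeight_snoc, Fin.init_snoc]
  linear_combination wordWeight p v * g v * hp

lemma wordMean_score_init {p : Bool → ℝ} (hp : p true + p false = 1) (s : Bool → ℝ) {n : ℕ}
    (g : (Fin n → Bool) → ℝ) :
    wordMean p (fun w : Fin (n + 1) → Bool => wordScore s w * g (Fin.init w)) =
      wordMean p (fun v => wordScore s v * g v) +
        (p true * s true + p false * s false) * wordMean p g := by
  simp only [wordMean]
  rw [sum_words_succ, Finset.mul_sum, ← Finset.sum_add_distrib]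
  refine Finset.sum_congr rfl fun v _ => ?_
  simp only [wordWeight_snoc, wordScore_snoc, Fin.init_snoc]
  linear_combination wordWeight p v * wordScore s v * g v * hp

/-! ### Sequential tests and Wald's identity -/

/-- A randomized sequential test: after reading the word `w` it is still running with probability
`running n w`, and has stopped exactly there accepting or rejecting with probability
`accept n w` and `reject n w`. -/
structure SequentialTest where
  running : (n : ℕ) → (Fin n → Bool) → ℝ
  accept : (n : ℕ) → (Fin n → Bool) → ℝ
  reject : (n : ℕ) → (Fin n → Bool) → ℝ
  running_nonneg : ∀ n w, 0 ≤ running n w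
  accept_nonneg : ∀ n w, 0 ≤ accept n w
  reject_nonneg : ∀ n w, 0 ≤ reject n w
  zero : ∀ w, accept 0 w + reject 0 w + running 0 w = 1
  succ : ∀ n w, accept (n + 1) w + reject (n + 1) w + running (n + 1) w = running n (Fin.init w)

namespace SequentialTest

variable (t : SequentialTest)

/-- The probability that the test accepts after at most `T` letters. -/
noncomputable def acceptProb (p : Bool → ℝ) (T : ℕ) : ℝ :=
  ∑ n ∈ Finset.range (T + 1), wordMean p (t.accept n)

/-- The probability that the test rejects after at most `T` letters or runs longer. -/
noncomputable def otherProb (p : Bool → ℝ) (T : ℕ) : ℝ :=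
  ∑ n ∈ Finset.range (T + 1), wordMean p (t.reject n) + wordMean p (t.running T)

/-- Counting the runs still going at time `T` as non-accepting keeps the total mass 1, so almost
sure stopping is never needed. -/
lemma acceptProb_add_otherProb {p : Bool → ℝ} (hp : p true + p false = 1) (T : ℕ) :
    t.acceptProb p T + t.otherProb p T = 1 := by
  induction T with
  | zero =>
    have h := congrArg (wordMean p) (funext t.zero)
    simp only [wordMean_add] at h
    simp only [acceptProb, otherProb, zero_add, Finset.sum_range_one]
    rw [← add_assoc, h]
    simp [wordMean, wordWeight]
  | succ T ih =>
    have h := congrArg (wordMean p) (funext (t.succ T))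
    simp only [wordMean_add, wordMean_init hp] at h
    simp only [acceptProb, otherProb] at ih ⊢
    rw [Finset.sum_range_succ _ (T + 1), Finset.sum_range_succ _ (T + 1)]
    linarith

/-- Wald's identity for the score accumulated up to time `T`. -/
lemma sum_score {p : Bool → ℝ} (hp : p true + p false = 1) (s : Bool → ℝ) (T : ℕ) :
    ∑ n ∈ Finset.range (T + 1), wordMean p (fun w => wordScore s w * t.accept n w) +
      (∑ n ∈ Finset.range (T + 1), wordMean p (fun w => wordScore s w * t.reject n w) +
        wordMean p (fun w => wordScore s w * t.running T w)) =
      (p true * s true + p false * s false) *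
        ∑ n ∈ Finset.range T, wordMean p (t.running n) := by
  induction T with
  | zero => simp [wordMean, wordScore]
  | succ T ih =>
    -- The mass running at time `T` reads one more letter, which adds the mean score of a letter.
    have h := congrArg (wordMean p)
      (funext fun w => congrArg (fun x => wordScore s w * x) (t.succ T w))
    simp only [mul_add, wordMean_add, wordMean_score_init hp] at h
    rw [Finset.sum_range_succ _ (T + 1), Finset.sum_range_succ _ (T + 1),
      Finset.sum_range_succ (fun n => wordMean p (t.running n)) T, mul_add]
    linarith

end SequentialTest

/-! ### Likelihood ratios and data processing -/

/-- The logarithmic likelihood ratio of one letter. -/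
noncomputable def logRatio (p q : Bool → ℝ) (b : Bool) : ℝ := Real.log (q b / p b)

lemma wordWeight_mul_score_le {p q : Bool → ℝ} (hp : ∀ b, 0 ≤ p b) (hq : ∀ b, 0 < q b) {a : ℝ}
    (ha : 0 < a) {n : ℕ} (w : Fin n → Bool) :
    wordWeight p w * wordScore (logRatio p q) w ≤
      wordWeight q w / a + (Real.log a - 1) * wordWeight p w := by
  have hQ : 0 < wordWeight q w := Finset.prod_pos fun _ _ => hq _
  -- A letter may have `p`-probability zero (`μ = 0`); the meaningless score is then multiplied by
  -- zero.
  rcases (wordWeight_nonneg hp w).eq_or_lt with h | h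
  · rw [← h]
    simp only [zero_mul, mul_zero, add_zero]
    positivity
  · have hpi : ∀ i, p (w i) ≠ 0 := fun i h0 =>
      h.ne' (Finset.prod_eq_zero (Finset.mem_univ i) h0)
    have hs : wordScore (logRatio p q) w = Real.log (wordWeight q w / wordWeight p w) := by
      simp only [wordScore, logRatio, wordWeight]
      rw [← Finset.prod_div_distrib, Real.log_prod]
      exact fun i _ => div_ne_zero (hq _).ne' (hpi i)
    -- This is the tangent to the logarithm at `a`, linear in the likelihood ratio.
    have hl := Real.log_le_sub_one_of_pos (show 0 < wordWeight q w / wordWeight p w / a by positivity)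
    rw [Real.log_div (by positivity) ha.ne'] at hl
    rw [hs]
    have := mul_le_mul_of_nonneg_left hl h.le
    have e : wordWeight p w * (wordWeight q w / wordWeight p w / a - 1) =
        wordWeight q w / a - wordWeight p w := by field_simp
    linarith

lemma wordMean_score_le {p q : Bool → ℝ} (hp : ∀ b, 0 ≤ p b) (hq : ∀ b, 0 < q b) {a : ℝ}
    (ha : 0 < a) {n : ℕ} {g : (Fin n → Bool) → ℝ} (hg : ∀ w, 0 ≤ g w) :
    wordMean p (fun w => wordScore (logRatio p q) w * g w) ≤
      wordMean q g / a + (Real.log a - 1) * wordMean p g := by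
  simp only [wordMean]
  rw [Finset.sum_div, Finset.mul_sum, ← Finset.sum_add_distrib]
  refine Finset.sum_le_sum fun w _ => ?_
  have := mul_le_mul_of_nonneg_right (wordWeight_mul_score_le hp hq ha w) (hg w)
  calc _ = wordWeight p w * wordScore (logRatio p q) w * g w := by ring
    _ ≤ _ := this
    _ = _ := by ring

/-- Data processing for a sequential test, in variational form. -/
lemma SequentialTest.score_le (t : SequentialTest) {p q : Bool → ℝ} (hp : ∀ b, 0 ≤ p b)
    (hp1 : p true + p false = 1) (hq : ∀ b, 0 < q b) (hq1 : q true + q false = 1)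
    {a b : ℝ} (ha : 0 < a) (hb : 0 < b) (T : ℕ) :
    (p true * logRatio p q true + p false * logRatio p q false) *
        ∑ n ∈ Finset.range T, wordMean p (t.running n) ≤
      t.acceptProb q T / a + (1 - t.acceptProb q T) / b - 1 +
        t.acceptProb p T * Real.log a + (1 - t.acceptProb p T) * Real.log b := by
  rw [← t.sum_score hp1]
  -- The tangent point is `a` on acceptance and `b` on everything else.
  have h1 : ∑ n ∈ Finset.range (T + 1),
      wordMean p (fun w => wordScore (logRatio p q) w * t.accept n w) ≤
      t.acceptProb q T / a + (Real.log a - 1) * t.acceptProb p T := by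
    simp only [acceptProb]
    rw [Finset.sum_div, Finset.mul_sum, ← Finset.sum_add_distrib]
    exact Finset.sum_le_sum fun n _ => wordMean_score_le hp hq ha (t.accept_nonneg n)
  have h2 : ∑ n ∈ Finset.range (T + 1),
      wordMean p (fun w => wordScore (logRatio p q) w * t.reject n w) +
        wordMean p (fun w => wordScore (logRatio p q) w * t.running T w) ≤
      t.otherProb q T / b + (Real.log b - 1) * t.otherProb p T := by
    simp only [otherProb]
    rw [add_div, mul_add, Finset.sum_div, Finset.mul_sum, add_add_add_comm,
      ← Finset.sum_add_distrib]
    exact add_le_add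
      (Finset.sum_le_sum fun n _ => wordMean_score_le hp hq hb (t.reject_nonneg n))
      (wordMean_score_le hp hq hb (t.running_nonneg T))
  have e1 := t.acceptProb_add_otherProb hp1 T
  have e2 := t.acceptProb_add_otherProb hq1 T
  rw [show t.otherProb p T = 1 - t.acceptProb p T by linarith,
    show t.otherProb q T = 1 - t.acceptProb q T by linarith] at h2
  linarith

/-! ### Divergences between Bernoulli laws -/

/-- The law on `Bool` with mean `x`. -/
def bitLaw (x : ℝ) (b : Bool) : ℝ := if b then x else 1 - x

lemma mul_log_ratio_ge {x y : ℝ} (hx : 0 ≤ x) (hy : 0 < y) :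
    -(x * Real.log (y / x)) ≤ x * (x / y - 1) := by
  rcases hx.eq_or_lt with rfl | hx
  · simp
  · rw [← mul_neg, ← Real.log_inv, inv_div]
    exact mul_le_mul_of_nonneg_left (Real.log_le_sub_one_of_pos (by positivity)) hx.le

/-- The Kullback–Leibler divergence of two bits is at most their `χ²` divergence. -/
lemma neg_logRatio_mean_le {x y : ℝ} (hx0 : 0 ≤ x) (hx1 : x ≤ 1) (hy0 : 0 < y) (hy1 : y < 1) :
    -(bitLaw x true * logRatio (bitLaw x) (bitLaw y) true +
        bitLaw x false * logRatio (bitLaw x) (bitLaw y) false) ≤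
      (x - y) ^ 2 / (y * (1 - y)) := by
  simp only [bitLaw, logRatio, if_true, Bool.false_eq_true, if_false]
  have h1 := mul_log_ratio_ge hx0 hy0
  have h2 := mul_log_ratio_ge (sub_nonneg.2 hx1) (sub_pos.2 hy1)
  have hy : (0 : ℝ) < 1 - y := sub_pos.2 hy1
  have e : x * (x / y - 1) + (1 - x) * ((1 - x) / (1 - y) - 1) =
      (x - y) ^ 2 / (y * (1 - y)) := by
    field_simp
    ring
  linarith

/-- The divergence between bits of means `ρ` and `1 - δ` dominates `log (1 / δ)`. -/
lemma exists_mul_log_le_divergence {ρ δ₀ : ℝ} (hρ : 0 < ρ) (hδ₀ : 0 < δ₀) (h : ρ + δ₀ < 1) :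
    ∃ c : ℝ, 0 < c ∧ ∀ δ, 0 < δ → δ ≤ δ₀ →
      c * Real.log (1 / δ) ≤
        -(ρ * Real.log ((1 - δ) / ρ) + (1 - ρ) * Real.log (δ / (1 - ρ))) := by
  have hρ1 : 0 < 1 - ρ := by linarith
  have hδ1 : 0 < 1 - δ₀ := by linarith
  -- `B` is the divergence at `δ₀`; `A` bounds from below its growth rate in `log (1 / δ)` as `δ`
  -- decreases from `δ₀`.
  set A := (1 - ρ - δ₀) / (1 - δ₀) with hA
  set B := -(ρ * Real.log ((1 - δ₀) / ρ) + (1 - ρ) * Real.log (δ₀ / (1 - ρ))) with hB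
  have hA0 : 0 < A := div_pos (by linarith) hδ1
  have hB0 : 0 < B := by
    have h1 := mul_lt_mul_of_pos_left (Real.log_lt_sub_one_of_pos (div_pos hδ1 hρ)
      (by rw [Ne, div_eq_one_iff_eq hρ.ne']; linarith)) hρ
    have h2 := mul_le_mul_of_nonneg_left (Real.log_le_sub_one_of_pos (div_pos hδ₀ hρ1)) hρ1.le
    have e1 : ρ * ((1 - δ₀) / ρ - 1) = 1 - δ₀ - ρ := by field_simp
    have e2 : (1 - ρ) * (δ₀ / (1 - ρ) - 1) = δ₀ - (1 - ρ) := by field_simp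
    linarith
  have hL : 0 < Real.log (1 / δ₀) := Real.log_pos (by rw [lt_div_iff₀ hδ₀]; linarith)
  refine ⟨min A (B / Real.log (1 / δ₀)), lt_min hA0 (div_pos hB0 hL), fun δ hδ hle => ?_⟩
  have hδ' : 0 < 1 - δ := by linarith
  have l1 : Real.log (1 - δ) - Real.log (1 - δ₀) ≤ (δ₀ - δ) / (1 - δ₀) := by
    rw [← Real.log_div hδ'.ne' hδ1.ne']
    refine (Real.log_le_sub_one_of_pos (by positivity)).trans_eq ?_
    field_simp
    ring
  have l2 : (δ₀ - δ) / δ₀ ≤ Real.log δ₀ - Real.log δ := by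
    have := Real.log_le_sub_one_of_pos (div_pos hδ hδ₀)
    rw [Real.log_div hδ.ne' hδ₀.ne'] at this
    have e : (δ₀ - δ) / δ₀ = 1 - δ / δ₀ := by field_simp
    linarith
  have l3 : 0 ≤ Real.log δ₀ - Real.log δ := sub_nonneg.2 (Real.log_le_log hδ hle)
  have m1 : ρ * (Real.log (1 - δ) - Real.log (1 - δ₀)) ≤
      ρ * (δ₀ / (1 - δ₀)) * (Real.log δ₀ - Real.log δ) := by
    calc _ ≤ ρ * ((δ₀ - δ) / (1 - δ₀)) := mul_le_mul_of_nonneg_left l1 hρ.le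
      _ = ρ * (δ₀ / (1 - δ₀)) * ((δ₀ - δ) / δ₀) := by field_simp
      _ ≤ _ := mul_le_mul_of_nonneg_left l2 (by positivity)
  have eA : A = 1 - ρ - ρ * (δ₀ / (1 - δ₀)) := by rw [hA]; field_simp; ring
  have key : A * (Real.log δ₀ - Real.log δ) + B ≤
      -(ρ * Real.log ((1 - δ) / ρ) + (1 - ρ) * Real.log (δ / (1 - ρ))) := by
    rw [hB, Real.log_div hδ'.ne' hρ.ne', Real.log_div hδ.ne' hρ1.ne',
      Real.log_div hδ1.ne' hρ.ne', Real.log_div hδ₀.ne' hρ1.ne', eA]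
    linarith
  refine le_trans ?_ key
  have e : Real.log (1 / δ) = (Real.log δ₀ - Real.log δ) + Real.log (1 / δ₀) := by
    rw [one_div, one_div, Real.log_inv, Real.log_inv]
    ring
  rw [e, mul_add]
  refine add_le_add (mul_le_mul_of_nonneg_right (min_le_left _ _) l3) ?_
  calc _ ≤ B / Real.log (1 / δ₀) * Real.log (1 / δ₀) :=
        mul_le_mul_of_nonneg_right (min_le_right _ _) hL.le
    _ = B := div_mul_cancel₀ _ hL.ne'

/-! ### Separated alternatives -/

/-- Around every mean below `1 / 2` there are `K` means that are separated by more than `2 * ε`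
but hard to distinguish from it. -/
lemma exists_separated_means {ε₀ δ₀ : ℝ} (hε₀ : 0 < ε₀) (hδ₀ : 0 < δ₀) (h₀ : 2 * ε₀ + δ₀ < 1) :
    ∃ K : ℕ, 0 < K ∧ 1 / (K : ℝ) + δ₀ < 1 ∧ ∃ C : ℝ, 0 < C ∧
      ∀ ε μ : ℝ, 0 < ε → ε ≤ ε₀ → 0 ≤ μ → μ < 1 / 2 →
        ∃ ν : Fin K → ℝ, (∀ i, 0 < ν i ∧ ν i < 1) ∧
          (∀ i j, i < j → ν i + 2 * ε < ν j) ∧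
          ∀ i, (μ - ν i) ^ 2 / (ν i * (1 - ν i)) ≤ C * (ε ^ 2 / max μ ε) := by
  set K := ⌈1 / (2 * ε₀)⌉₊ with hK
  have hKl : 1 / (2 * ε₀) ≤ K := Nat.le_ceil _
  have hKu : (K : ℝ) < 1 / (2 * ε₀) + 1 := Nat.ceil_lt_add_one (by positivity)
  have hK0 : 1 < (K : ℝ) := lt_of_lt_of_le (by rw [lt_div_iff₀ (by positivity)]; linarith) hKl
  -- A quarter of the room left in the unit interval by `K` points at spacing `2 * ε₀`.
  set η := (1 - (K - 1) * (2 * ε₀)) / 4 with hη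
  have hKε : ((K : ℝ) - 1) * (2 * ε₀) < 1 := by
    rw [← lt_div_iff₀ (by positivity)]
    linarith
  have hη0 : 0 < η := by linarith
  have hKε0 : 0 < ((K : ℝ) - 1) * (2 * ε₀) := mul_pos (by linarith) (by positivity)
  have hη4 : η < 1 / 4 := by linarith
  refine ⟨K, by exact_mod_cast zero_lt_one.trans hK0, ?_, ?_⟩
  · have : 1 / (K : ℝ) ≤ 2 * ε₀ := by
      rw [div_le_iff₀ (by linarith)]
      rw [div_le_iff₀ (by positivity)] at hKl
      linarith
    linarith
  -- Below this threshold, `K` steps of length `3 * ε` to the right of `μ` stay below `3 / 4`.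
  set e := 1 / (12 * (K : ℝ)) with he
  have he0 : 0 < e := by positivity
  refine ⟨36 * (K : ℝ) ^ 2 + 2 / η / e ^ 2, by positivity, fun ε μ hε hle hμ0 hμ => ?_⟩
  have hmax : 0 < max μ ε := lt_max_of_lt_right hε
  have hcast : ∀ i : Fin K, (0 : ℝ) ≤ i ∧ (i : ℝ) + 1 ≤ K := fun i =>
    ⟨Nat.cast_nonneg _, by exact_mod_cast i.2⟩
  by_cases hs : ε < e
  · have hεK : 3 * ε * K < 1 / 4 := by
      rw [he, lt_div_iff₀ (by positivity)] at hs
      linarith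
    have hb : ∀ i : Fin K, 3 * ε * ((i : ℝ) + 1) ≤ 3 * ε * K := fun i =>
      mul_le_mul_of_nonneg_left (hcast i).2 (by positivity)
    have hb' : ∀ i : Fin K, 3 * ε ≤ 3 * ε * ((i : ℝ) + 1) := fun i =>
      le_mul_of_one_le_right (by positivity) (by linarith [(hcast i).1])
    refine ⟨fun i => μ + 3 * ε * (i + 1), fun i => ?_, fun i j hij => ?_, fun i => ?_⟩
    · have := hb i; have := hb' i
      constructor <;> linarith
    · have h1 : (i : ℝ) + 1 ≤ j := by exact_mod_cast hij
      have := mul_le_mul_of_nonneg_left h1 (show 0 ≤ 3 * ε by positivity)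
      simp only
      linarith
    · have h1 := hb i
      have h2 := hb' i
      have h3 : max μ ε ≤ μ + 3 * ε * (i + 1) := max_le (by linarith) (by linarith)
      have h4 : max μ ε * (1 / 4) ≤ (μ + 3 * ε * (i + 1)) * (1 - (μ + 3 * ε * (i + 1))) :=
        mul_le_mul h3 (by linarith) (by norm_num) (hmax.le.trans h3)
      calc _ ≤ (3 * ε * K) ^ 2 / (max μ ε * (1 / 4)) := by
            refine div_le_div₀ (by positivity) ?_ (by positivity) h4
            rw [show μ - (μ + 3 * ε * (i + 1)) = -(3 * ε * (i + 1)) by ring, neg_sq]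
            exact pow_le_pow_left₀ (by linarith) h1 2
        _ = 36 * (K : ℝ) ^ 2 * (ε ^ 2 / max μ ε) := by field_simp; norm_num
        _ ≤ _ := mul_le_mul_of_nonneg_right (le_add_of_nonneg_right (by positivity))
            (by positivity)
  -- For `ε ≥ e` the target `ε ^ 2 / max μ ε` is bounded below, so an even grid on `[η, 1 - η]`,
  -- independent of `μ`, suffices.
  · rw [not_lt] at hs
    have hK1 : 0 < (K : ℝ) - 1 := by linarith
    set s := (1 - 2 * η) / (K - 1) with hs'
    have hs2 : 2 * ε < s := by
      rw [hs', lt_div_iff₀ hK1]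
      have := mul_le_mul_of_nonneg_right hle hK1.le
      linarith
    have hs0 : 0 < s := by linarith
    have hsK : s * (K - 1) = 1 - 2 * η := div_mul_cancel₀ _ hK1.ne'
    have hb : ∀ i : Fin K, s * (i : ℝ) ≤ 1 - 2 * η := fun i =>
      hsK ▸ mul_le_mul_of_nonneg_left (by linarith [(hcast i).2]) hs0.le
    have hb' : ∀ i : Fin K, 0 ≤ s * (i : ℝ) := fun i => mul_nonneg hs0.le (hcast i).1
    refine ⟨fun i => η + s * i, fun i => ?_, fun i j hij => ?_, fun i => ?_⟩
    · have := hb i; have := hb' i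
      constructor <;> linarith
    · have h1 : (i : ℝ) + 1 ≤ j := by exact_mod_cast hij
      have := mul_le_mul_of_nonneg_left h1 hs0.le
      simp only
      linarith
    · have h1 := hb i
      have h2 := hb' i
      have h3 : η / 2 ≤ (η + s * i) * (1 - (η + s * i)) := by
        nlinarith [mul_nonneg h2 (sub_nonneg.2 h1)]
      have h4 : e ^ 2 ≤ ε ^ 2 / max μ ε := by
        have hm : max μ ε ≤ 1 := max_le (by linarith) (by linarith)
        calc e ^ 2 ≤ ε ^ 2 := pow_le_pow_left₀ he0.le hs 2
          _ ≤ _ := le_div_self (by positivity) hmax hm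
      calc _ ≤ 1 / (η / 2) := by
            refine div_le_div₀ (by norm_num) ?_ (by positivity) h3
            rw [sq_le_one_iff_abs_le_one, abs_le]
            constructor <;> linarith
        _ = 2 / η / e ^ 2 * e ^ 2 := by field_simp
        _ ≤ 2 / η / e ^ 2 * (ε ^ 2 / max μ ε) := mul_le_mul_of_nonneg_left h4 (by positivity)
        _ ≤ _ := mul_le_mul_of_nonneg_right (le_add_of_nonneg_left (by positivity))
            (by positivity)

/-! ### Cylinder probabilities -/

instance (μ : I) : IsProbabilityMeasure (bernoulliSequence μ) := by
  unfold bernoulliSequence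
  infer_instance

lemma measurableSet_initialBits_eq (n : ℕ) (w : Fin n → Bool) :
    MeasurableSet (initialBits n ⁻¹' {w}) := by
  have h : Measurable (initialBits n) := measurable_pi_lambda _ fun i => measurable_pi_apply _
  exact h (measurableSet_singleton w)

lemma bernoulliMeasure_real_singleton (μ : I) (b : Bool) :
    (bernoulliMeasure true false μ).real {b} = bitLaw μ b := by
  rw [bernoulliMeasure_real_apply _ (measurableSet_singleton b)]
  cases b <;> simp [bitLaw]

lemma bernoulliSequence_real_initialBits_eq (μ : I) (n : ℕ) (w : Fin n → Bool) :
    (bernoulliSequence μ).real (initialBits n ⁻¹' {w}) = wordWeight (bitLaw μ) w := by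
  set t : ℕ → Set Bool := fun i => if h : i < n then {w ⟨i, h⟩} else Set.univ with ht
  have hset : initialBits n ⁻¹' {w} = Set.pi (Finset.range n : Finset ℕ) t := by
    ext z
    simp only [Set.mem_preimage, Set.mem_singleton_iff, funext_iff, initialBits, Set.mem_pi,
      Finset.coe_range, Set.mem_Iio, ht]
    constructor
    · intro h i hi
      rw [dif_pos hi]
      exact h ⟨i, hi⟩
    · intro h i
      have := h i i.2
      rwa [dif_pos i.2] at this
  rw [measureReal_def, bernoulliSequence, hset,
    Measure.infinitePi_pi _ (fun i _ => MeasurableSet.of_discrete), ENNReal.toReal_prod,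
    Finset.prod_range, wordWeight]
  refine Finset.prod_congr rfl fun i _ => ?_
  rw [ht]
  simp only [i.2, dif_pos, Fin.eta]
  exact bernoulliMeasure_real_singleton μ (w i)

lemma cylinder_eq_iUnion {Seed : Type*} (n : ℕ) (G : Seed → (Fin n → Bool) → Prop) :
    {p : Seed × (ℕ → Bool) | G p.1 (initialBits n p.2)} =
      ⋃ w, {r | G r w} ×ˢ (initialBits n ⁻¹' {w}) := by
  ext p
  simp

namespace SequentialAlgorithm

variable {Seed : Type*} [MeasurableSpace Seed] (A : SequentialAlgorithm Seed)

instance : IsProbabilityMeasure A.seedLaw := A.isProbabilityMeasure_seedLaw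

instance (μ : I) : IsProbabilityMeasure (A.runLaw μ) := by
  unfold runLaw
  infer_instance

lemma measurableSet_cylinder {n : ℕ} {G : Seed → (Fin n → Bool) → Prop}
    (hG : ∀ w, MeasurableSet {r | G r w}) :
    MeasurableSet {p : Seed × (ℕ → Bool) | G p.1 (initialBits n p.2)} := by
  rw [cylinder_eq_iUnion]
  exact MeasurableSet.iUnion fun w => (hG w).prod (measurableSet_initialBits_eq n w)

lemma runLaw_real_cylinder (μ : I) {n : ℕ} {G : Seed → (Fin n → Bool) → Prop}
    (hG : ∀ w, MeasurableSet {r | G r w}) :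
    (A.runLaw μ).real {p | G p.1 (initialBits n p.2)} =
      wordMean (bitLaw μ) fun w => A.seedLaw.real {r | G r w} := by
  rw [cylinder_eq_iUnion, measureReal_iUnion_fintype _
    fun w => (hG w).prod (measurableSet_initialBits_eq n w)]
  · refine Finset.sum_congr rfl fun w _ => ?_
    rw [runLaw, measureReal_prod_prod, bernoulliSequence_real_initialBits_eq, mul_comm]
  · intro v w hvw
    rw [Function.onFun, Set.disjoint_left]
    rintro p ⟨_, h1⟩ ⟨_, h2⟩
    exact hvw (h1.symm.trans h2)

/-! ### From the algorithm to a test -/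

/-- The algorithm does not halt before it has read all of `w`. -/
def reaches : (n : ℕ) → Seed → (Fin n → Bool) → Prop
  | 0, _, _ => True
  | n + 1, r, w => reaches n r (Fin.init w) ∧ ¬ A.halts n r (Fin.init w) = true

lemma measurableSet_halts (n : ℕ) (w : Fin n → Bool) :
    MeasurableSet {r | A.halts n r w = true} :=
  A.measurable_halts n w (measurableSet_singleton true)

lemma measurableSet_reaches : ∀ (n : ℕ) (w : Fin n → Bool), MeasurableSet {r | A.reaches n r w}
  | 0, _ => MeasurableSet.univ
  | n + 1, w => (measurableSet_reaches n (Fin.init w)).diff (A.measurableSet_halts n (Fin.init w))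

lemma reaches_initialBits (n : ℕ) (p : Seed × (ℕ → Bool)) :
    A.reaches n p.1 (initialBits n p.2) ↔ (n : ℕ∞) ≤ A.samples p := by
  have h : ∀ n, A.reaches n p.1 (initialBits n p.2) ↔
      ∀ m < n, ¬ A.halts m p.1 (initialBits m p.2) = true := by
    intro n
    induction n with
    | zero => simp [reaches]
    | succ n ih =>
      rw [Nat.forall_lt_succ_right, ← ih]
      rfl
  rw [h, samples, le_iInf₂_iff]
  refine forall_congr' fun m => ?_
  rw [Nat.cast_le, ← not_lt]
  tauto

lemma samples_eq_iff (n : ℕ) (p : Seed × (ℕ → Bool)) :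
    A.samples p = n ↔
      A.reaches n p.1 (initialBits n p.2) ∧ A.halts n p.1 (initialBits n p.2) = true := by
  have h1 := A.reaches_initialBits (n + 1) p
  rw [Nat.cast_add, Nat.cast_one, ENat.add_one_le_iff (ENat.natCast_ne_top n)] at h1
  have h2 : A.reaches (n + 1) p.1 (initialBits (n + 1) p.2) ↔
      A.reaches n p.1 (initialBits n p.2) ∧ ¬ A.halts n p.1 (initialBits n p.2) = true := Iff.rfl
  rw [eq_comm, eq_iff_le_not_lt, ← h1, h2, A.reaches_initialBits n p]
  tauto

/-- After reading `w` the algorithm halts, and its output is within `ε` of `m`. -/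
def succeeds (ε m : ℝ) (n : ℕ) (r : Seed) (w : Fin n → Bool) : Prop :=
  (A.reaches n r w ∧ A.halts n r w = true) ∧ |A.output n r w - m| ≤ ε

lemma measurableSet_output_near (ε m : ℝ) (n : ℕ) (w : Fin n → Bool) :
    MeasurableSet {r | |A.output n r w - m| ≤ ε} :=
  measurableSet_le ((A.measurable_output n w).sub_const m).abs measurable_const

lemma measurableSet_succeeds (ε m : ℝ) (n : ℕ) (w : Fin n → Bool) :
    MeasurableSet {r | A.succeeds ε m n r w} :=
  ((A.measurableSet_reaches n w).inter (A.measurableSet_halts n w)).inter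
    (A.measurableSet_output_near ε m n w)

lemma successEvent_eq_iUnion (ε : ℝ) (μ : I) :
    A.successEvent ε μ = ⋃ n, {p | A.succeeds ε μ n p.1 (initialBits n p.2)} := by
  ext p
  simp only [successEvent, succeeds, samples_eq_iff, Set.mem_ofPred_eq, Set.mem_iUnion]

lemma measurableSet_successEvent (ε : ℝ) (μ : I) : MeasurableSet (A.successEvent ε μ) := by
  rw [successEvent_eq_iUnion]
  exact MeasurableSet.iUnion fun n => measurableSet_cylinder (A.measurableSet_succeeds ε μ n)

/-- Averaging over the seed turns the algorithm into a test that accepts outputs near `m`. -/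
noncomputable def toTest (ε m : ℝ) : SequentialTest where
  running n w := A.seedLaw.real ({r | A.reaches n r w} \ {r | A.halts n r w = true})
  accept n w := A.seedLaw.real {r | A.succeeds ε m n r w}
  reject n w := A.seedLaw.real
    ({r | A.reaches n r w ∧ A.halts n r w = true} \ {r | |A.output n r w - m| ≤ ε})
  running_nonneg _ _ := measureReal_nonneg
  accept_nonneg _ _ := measureReal_nonneg
  reject_nonneg _ _ := measureReal_nonneg
  zero w := by
    have h := measureReal_inter_add_sdiff (μ := A.seedLaw)
      (s := {r | A.reaches 0 r w ∧ A.halts 0 r w = true}) (A.measurableSet_output_near ε m 0 w)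
    have h' := measureReal_inter_add_sdiff (μ := A.seedLaw)
      (s := {r | A.reaches 0 r w})
      (A.measurableSet_halts 0 w)
    have u : {r : Seed | A.reaches 0 r w} = Set.univ := by simp [reaches]
    have h1 : A.seedLaw.real {r : Seed | A.reaches 0 r w} = 1 := by rw [u, probReal_univ]
    exact (congrArg (· + _) h).trans (h'.trans h1)
  succ n w := by
    have h := measureReal_inter_add_sdiff (μ := A.seedLaw)
      (s := {r | A.reaches (n + 1) r w ∧ A.halts (n + 1) r w = true})
      (A.measurableSet_output_near ε m (n + 1) w)
    have h' := measureReal_inter_add_sdiff (μ := A.seedLaw)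
      (s := {r | A.reaches (n + 1) r w})
      (A.measurableSet_halts (n + 1) w)
    exact (congrArg (· + _) h).trans h'

lemma wordMean_accept (ε m : ℝ) (μ : I) (n : ℕ) :
    wordMean (bitLaw μ) ((A.toTest ε m).accept n) =
      (A.runLaw μ).real {p | A.succeeds ε m n p.1 (initialBits n p.2)} :=
  (A.runLaw_real_cylinder μ (A.measurableSet_succeeds ε m n)).symm

/-- A test still running after `n` letters inspects at least one more, hence `n + 1`. -/
lemma wordMean_running (ε m : ℝ) (μ : I) (n : ℕ) :
    wordMean (bitLaw μ) ((A.toTest ε m).running n) =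
      (A.runLaw μ).real {p | ((n + 1 : ℕ) : ℕ∞) ≤ A.samples p} := by
  simp only [← reaches_initialBits]
  exact (A.runLaw_real_cylinder μ fun w =>
    (A.measurableSet_reaches n w).diff (A.measurableSet_halts n w)).symm

lemma hasSum_successEvent (ε : ℝ) (μ ν : I) :
    HasSum (fun n => wordMean (bitLaw μ) ((A.toTest ε ν).accept n))
      ((A.runLaw μ).real (A.successEvent ε ν)) := by
  simp only [wordMean_accept]
  have hd : Pairwise (Function.onFun Disjoint
      fun n => {p : Seed × (ℕ → Bool) | A.succeeds ε ν n p.1 (initialBits n p.2)}) := by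
    intro m n hmn
    rw [Function.onFun, Set.disjoint_left]
    rintro p ⟨h1, -⟩ ⟨h2, -⟩
    rw [← samples_eq_iff] at h1 h2
    exact hmn (by exact_mod_cast h1.symm.trans h2)
  have hm := measure_iUnion (μ := A.runLaw μ) hd
    fun n => measurableSet_cylinder (A.measurableSet_succeeds ε ν n)
  rw [successEvent_eq_iUnion, measureReal_def, hm]
  rw [ENNReal.tsum_toReal_eq fun n => measure_ne_top _ _]
  refine ENNReal.hasSum_toReal ?_
  rw [← hm]
  exact measure_ne_top _ _

lemma tendsto_acceptProb (ε : ℝ) (μ ν : I) :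
    Filter.Tendsto ((A.toTest ε ν).acceptProb (bitLaw μ)) Filter.atTop
      (nhds ((A.runLaw μ).real (A.successEvent ε ν))) :=
  (A.hasSum_successEvent ε μ ν).tendsto_sum_nat.comp (Filter.tendsto_add_atTop_nat 1)

/-- Tail-sum formula: the left side is the expectation of the sample size truncated at `T`. -/
lemma sum_running_le (ε m : ℝ) (μ : I) (hE : A.expectedSamples μ ≠ ⊤) (T : ℕ) :
    ∑ n ∈ Finset.range T, wordMean (bitLaw μ) ((A.toTest ε m).running n) ≤
      (A.expectedSamples μ).toReal := by
  have hmeas : ∀ n : ℕ, MeasurableSet {p | ((n + 1 : ℕ) : ℕ∞) ≤ A.samples p} := by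
    intro n
    simp only [← reaches_initialBits]
    exact measurableSet_cylinder (A.measurableSet_reaches (n + 1))
  simp only [wordMean_running, measureReal_def]
  rw [← ENNReal.toReal_sum fun n _ => measure_ne_top _ _]
  refine ENNReal.toReal_mono hE ?_
  calc ∑ n ∈ Finset.range T, A.runLaw μ {p | ((n + 1 : ℕ) : ℕ∞) ≤ A.samples p}
      = ∫⁻ p, ∑ n ∈ Finset.range T,
          {p | ((n + 1 : ℕ) : ℕ∞) ≤ A.samples p}.indicator 1 p ∂(A.runLaw μ) := by
        rw [lintegral_finsetSum _ fun n _ => measurable_one.indicator (hmeas n)]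
        exact Finset.sum_congr rfl fun n _ => (lintegral_indicator_one (hmeas n)).symm
    _ ≤ A.expectedSamples μ := lintegral_mono fun p => by
        simp only [Set.indicator_apply, Set.mem_ofPred_eq, Pi.one_apply, Finset.sum_boole]
        induction A.samples p using ENat.recTopCoe with
        | top => simp
        | coe N =>
          have : {n ∈ Finset.range T | ((n + 1 : ℕ) : ℕ∞) ≤ (N : ℕ∞)} ⊆ Finset.range N := by
            intro n hn
            rw [Finset.mem_filter, Nat.cast_le] at hn
            exact Finset.mem_range.2 hn.2
          have := Finset.card_le_card this
          rw [Finset.card_range] at this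
          exact_mod_cast this

/-! ### The lower bound on the sample size -/

/-- If the algorithm rarely estimates `ν` when the mean is `μ`, but usually does when it is `ν`,
then it inspects many bits when the mean is `μ`. -/
lemma divergence_le_mul_expectedSamples {ε δ ρ : ℝ} {μ ν : I} (hδ : 0 < δ) (hρ : 0 < ρ)
    (hρδ : ρ + δ < 1) (hν0 : 0 < (ν : ℝ)) (hν1 : (ν : ℝ) < 1)
    (hμS : (A.runLaw μ).real (A.successEvent ε ν) ≤ ρ)
    (hνS : 1 - δ ≤ (A.runLaw ν).real (A.successEvent ε ν)) (hE : A.expectedSamples μ ≠ ⊤) :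
    -(ρ * Real.log ((1 - δ) / ρ) + (1 - ρ) * Real.log (δ / (1 - ρ))) ≤
      ((μ : ℝ) - ν) ^ 2 / (ν * (1 - ν)) * (A.expectedSamples μ).toReal := by
  set t := A.toTest ε ν with ht
  -- These are the likelihood ratios of the bits of means `1 - δ` and `ρ`, where the variational
  -- bound is sharp.
  set a := (1 - δ) / ρ with ha
  set b := δ / (1 - ρ) with hb
  set χ := ((μ : ℝ) - ν) ^ 2 / (ν * (1 - ν)) with hχ
  have hρ1 : 0 < 1 - ρ := by linarith
  have hδ1 : 0 < 1 - δ := by linarith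
  have ha0 : 0 < a := by positivity
  have hb0 : 0 < b := by positivity
  have hba : b ≤ a := by
    have h1 : 1 ≤ a := by rw [ha, le_div_iff₀ hρ]; linarith
    have h2 : b ≤ 1 := by rw [hb, div_le_iff₀ hρ1]; linarith
    exact h2.trans h1
  have hlog : Real.log b ≤ Real.log a := Real.log_le_log hb0 hba
  have hμ0 : (0 : ℝ) ≤ μ := μ.2.1
  have hμ1 : (μ : ℝ) ≤ 1 := μ.2.2
  have hp : ∀ c, 0 ≤ bitLaw μ c := by
    intro c; cases c <;> simp [bitLaw, hμ0, hμ1]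
  have hq : ∀ c, 0 < bitLaw ν c := by
    intro c; cases c <;> simp [bitLaw, hν0, hν1]
  have hp1 : bitLaw μ true + bitLaw μ false = 1 := by simp [bitLaw]
  have hq1 : bitLaw ν true + bitLaw ν false = 1 := by simp [bitLaw]
  have hχ0 : 0 ≤ χ := div_nonneg (sq_nonneg _) (mul_nonneg hν0.le (by linarith))
  have hT : ∀ T, -(χ * (A.expectedSamples μ).toReal) ≤
      t.acceptProb (bitLaw ν) T / a + (1 - t.acceptProb (bitLaw ν) T) / b - 1 +
        ρ * Real.log a + (1 - ρ) * Real.log b := by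
    intro T
    have h1 := t.score_le hp hp1 hq hq1 ha0 hb0 T
    have h2 := neg_logRatio_mean_le hμ0 hμ1 hν0 hν1
    have h3 := A.sum_running_le ε ν μ hE T
    have h4 : 0 ≤ ∑ n ∈ Finset.range T, wordMean (bitLaw μ) (t.running n) :=
      Finset.sum_nonneg fun n _ => wordMean_nonneg hp (t.running_nonneg n)
    have h5 : t.acceptProb (bitLaw μ) T ≤ ρ :=
      (sum_le_hasSum _ (fun n _ => wordMean_nonneg hp (t.accept_nonneg n))
        (A.hasSum_successEvent ε μ ν)).trans hμS
    have h6 := mul_le_mul_of_nonneg_right h2 h4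
    have h7 := mul_le_mul_of_nonneg_left h3 hχ0
    -- Since `b ≤ a`, raising the acceptance probability under `μ` to `ρ` only increases the bound.
    have h8 := mul_le_mul_of_nonneg_right h5 (sub_nonneg.2 hlog)
    linarith
  have hlim := A.tendsto_acceptProb ε ν ν
  have h := ge_of_tendsto' ((((hlim.div_const a).add
    ((hlim.const_sub 1).div_const b)).sub_const 1).add_const (ρ * Real.log a)
      |>.add_const ((1 - ρ) * Real.log b)) hT
  set Q := (A.runLaw ν).real (A.successEvent ε ν)
  -- Equality holds at `Q = 1 - δ`, and the left side is nonincreasing in `Q` because `b ≤ a`.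
  have hQ : Q / a + (1 - Q) / b ≤ 1 := by
    have e : (1 - δ) / a + δ / b = 1 := by
      rw [ha, hb]
      field_simp
      ring
    have h1 : (Q - (1 - δ)) / a ≤ (Q - (1 - δ)) / b :=
      div_le_div_of_nonneg_left (by linarith) hb0 hba
    have e1 : Q / a = (1 - δ) / a + (Q - (1 - δ)) / a := by ring
    have e2 : (1 - Q) / b = δ / b - (Q - (1 - δ)) / b := by ring
    linarith
  linarith

lemma disjoint_successEvent {ε : ℝ} {ν ν' : I} (h : (ν : ℝ) + 2 * ε < ν') :
    Disjoint (A.successEvent ε ν) (A.successEvent ε ν') := by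
  rw [Set.disjoint_left]
  rintro p ⟨n, hn, h1⟩ ⟨m, hm, h2⟩
  obtain rfl : n = m := by exact_mod_cast hn.symm.trans hm
  rw [abs_le] at h1 h2
  linarith

/-- Pigeonhole on disjoint events; accuracy at `μ` itself plays no role. -/
lemma exists_successEvent_le {ε : ℝ} (μ : I) {K : ℕ} (hK : 0 < K) (ν : Fin K → I)
    (hν : ∀ i j, i < j → (ν i : ℝ) + 2 * ε < ν j) :
    ∃ i, (A.runLaw μ).real (A.successEvent ε (ν i)) ≤ 1 / K := by
  by_contra! h
  have hd : Pairwise (Function.onFun Disjoint fun i => A.successEvent ε (ν i)) := by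
    intro i j hij
    rcases lt_or_gt_of_ne hij with h | h
    · exact A.disjoint_successEvent (hν i j h)
    · exact (A.disjoint_successEvent (hν j i h)).symm
  have hs := measureReal_iUnion_fintype (μ := A.runLaw μ) hd
    fun i => A.measurableSet_successEvent ε (ν i)
  have h1 : ∑ i : Fin K, (1 : ℝ) / K < ∑ i, (A.runLaw μ).real (A.successEvent ε (ν i)) :=
    Finset.sum_lt_sum_of_nonempty ⟨⟨0, hK⟩, Finset.mem_univ _⟩ fun i _ => h i
  have hK' : (K : ℝ) ≠ 0 := by exact_mod_cast hK.ne'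
  rw [← hs, Finset.sum_const, Finset.card_univ, Fintype.card_fin, nsmul_eq_mul,
    mul_one_div_cancel hK'] at h1
  exact absurd h1 (not_lt.2 measureReal_le_one)

lemma expectedSamples_le_expectedTime (μ : I) : A.expectedSamples μ ≤ A.expectedTime μ :=
  lintegral_mono fun _ => le_self_add

end SequentialAlgorithm

theorem lemma10 (ε₀ δ₀ : ℝ) (h₀ : 2 * ε₀ + δ₀ < 1) :
    ∃ c : ℝ, 0 < c ∧
      ∀ (ε δ : ℝ), 0 < ε → ε ≤ ε₀ → 0 < δ → δ ≤ δ₀ →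
      ∀ (Seed : Type*) [MeasurableSpace Seed] (A : SequentialAlgorithm Seed),
        A.EstimatesMean ε δ →
        ∀ μ : I, (μ : ℝ) < 1 / 2 →
          ENNReal.ofReal (c * (max (μ : ℝ) ε / ε ^ 2 * Real.log (1 / δ))) ≤ A.expectedSamples μ ∧
          ENNReal.ofReal (c * (max (μ : ℝ) ε / ε ^ 2 * Real.log (1 / δ))) ≤ A.expectedTime μ := by
  by_cases hpos : 0 < ε₀ ∧ 0 < δ₀
  swap
  · exact ⟨1, one_pos, fun ε δ hε hεε₀ hδ hδδ₀ =>
      absurd ⟨hε.trans_le hεε₀, hδ.trans_le hδδ₀⟩ hpos⟩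
  obtain ⟨hε₀, hδ₀⟩ := hpos
  obtain ⟨K, hK, hKδ, C, hC, hsep⟩ := exists_separated_means hε₀ hδ₀ h₀
  have hρ : 0 < 1 / (K : ℝ) := by positivity
  obtain ⟨c, hc, hdiv⟩ := exists_mul_log_le_divergence hρ hδ₀ hKδ
  refine ⟨c / C, by positivity, fun ε δ hε hεε₀ hδ hδδ₀ Seed _ A hA μ hμ => ?_⟩
  have hsamples : ENNReal.ofReal (c / C * (max (μ : ℝ) ε / ε ^ 2 * Real.log (1 / δ))) ≤
      A.expectedSamples μ := by
    by_cases hE : A.expectedSamples μ = ⊤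
    · rw [hE]
      exact le_top
    obtain ⟨ν, hν, hgap, hχ⟩ := hsep ε μ hε hεε₀ μ.2.1 hμ
    obtain ⟨i, hi⟩ := A.exists_successEvent_le (ε := ε) μ hK
      (fun i => ⟨ν i, (hν i).1.le, (hν i).2.le⟩) hgap
    have h1 := A.divergence_le_mul_expectedSamples hδ hρ (by linarith) (hν i).1 (hν i).2 hi
      (hA _) hE
    have h2 := (hdiv δ hδ hδδ₀).trans
      (h1.trans (mul_le_mul_of_nonneg_right (hχ i) ENNReal.toReal_nonneg))
    refine ENNReal.ofReal_le_of_le_toReal ?_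
    have hmax : 0 < max (μ : ℝ) ε := lt_max_of_lt_right hε
    calc c / C * (max (μ : ℝ) ε / ε ^ 2 * Real.log (1 / δ))
        = max (μ : ℝ) ε / (C * ε ^ 2) * (c * Real.log (1 / δ)) := by field_simp
      _ ≤ max (μ : ℝ) ε / (C * ε ^ 2) *
          (C * (ε ^ 2 / max (μ : ℝ) ε) * (A.expectedSamples μ).toReal) :=
        mul_le_mul_of_nonneg_left h2 (by positivity)
      _ = (A.expectedSamples μ).toReal := by field_simp
  exact ⟨hsamples, hsamples.trans (A.expectedSamples_le_expectedTime μ)⟩
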